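/- **Conventions.** Everything is smooth. $B^d\subset\mathbb{R}^d$ is the closed unit ball, $S^{d-1}=\partial B^d$, and $\coprod$ denotes a finite (possibly empty) disjoint union of copies. Let $V$ be a Euclidean space of dimension $n-1$, regarded as $S^{n-1}$ with the point $\infty$ removed. For a subset $L\subset V$, a system of *trivial $d$-balls* for $L$ is an embedding $\Phi:\coprod B^d\hookrightarrow V$ with $\Phi(\coprod S^{d-1})=L$; if one exists, $L$ is a *trivial $(d-1)$-link*. An *$(n,k)$-Kirby diagram* $\mathcal K=L_1\cup L_2\subset V$ consists of a trivial $(n-k-1)$-link $L_1$ (the dotted part) and a $(k-1)$-link $L_2$ (the framed part) for which there is an embedding $$\phi:\Big(\coprod S^{n-k-1}\Big)\amalg\Big(\coprod (S^{k-1}\times B^{n-k})\Big)\hookrightarrow V$$ with $L_1=\phi(\coprod S^{n-k-1})$ and $L_2=\phi(\coprod (S^{k-1}\times\{0\}))$. (Only the existence of a framing of $L_2$ is required; the framing is not part of the data.) **Theorem.** Let $k\ge 2$ and $n\ge 2k$ with $(n,k)\ne(4,2)$, and let $\mathcal K=L_1\cup L_2\subset\mathbb{R}^3$ be a $(4,2)$-Kirby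 diagram. Then there is an $(n,k)$-Kirby diagram $\tilde{\mathcal K}=\tilde L_1\cup\tilde L_2\subset\mathbb{R}^{n-k-2}\times\mathbb{R}^3\times\mathbb{R}^{k-2}$ such that $$\tilde{\mathcal K}\cap(\{0\}\times\mathbb{R}^3\times\{0\})=\{0\}\times\mathcal K\times\{0\}.$$ More precisely, $L_1$ has trivial $2$-disks in $\mathbb{R}^3$, and for every system $D_1:\coprod B^2\hookrightarrow\mathbb{R}^3$ of trivial $2$-disks for $L_1$ there is a system $D_2:\coprod B^2\hookrightarrow\mathbb{R}^{n-k-2}\times\mathbb{R}^3$ of trivial $2$-disks for $\{0\}\times L_2$ such that $\tilde{\mathcal K}$ can be taken to be the union of $$\tilde L_1=\{(u,D_1(v),0): u\in\mathbb{R}^{n-k-2},\ v\in\coprod B^2,\ |u|^2+|v|^2=1\},$$ $$\tilde L_2=\{(D_2(v),w): v\in\coprod B^2,\ w\in\mathbb{R}^{k-2},\ |v|^2+|w|^2=1\},$$ which are the boundaries, with corners rounded, of $B^{n-k-2}\times D_1\times\{0\}$ and of $D_2\times B^{k-2}$. Moreover $\tilde L_i\cap(\{0\}\times\mathbb{R}^3\times\{0\})=\{0\}\times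 L_i\times\{0\}$ for $i=1,2$. -/

import Mathlib

open scoped ContDiff

namespace KirbyDiag

/-- Euclidean space `ℝ^d` with its Euclidean norm. -/
abbrev Euc (d : ℕ) : Type := EuclideanSpace ℝ (Fin d)

/-- The standard closed ball `B^d ⊂ ℝ^d`. -/
abbrev unitBall (d : ℕ) : Set (Euc d) := Metric.closedBall 0 1

/-- The standard sphere `S^{d-1} = ∂B^d ⊂ ℝ^d`; the index `d` is the dimension of the ball. -/
abbrev unitSphere (d : ℕ) : Set (Euc d) := Metric.sphere 0 1

section Embeddings

variable {X V : Type*} [NormedAddCommGroup X] [NormedSpace ℝ X]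
  [NormedAddCommGroup V] [NormedSpace ℝ V]

/-- `f` is smooth on the arbitrary subset `S`: near each point of `S` it agrees on `S` with a
`C^∞` map defined on an open set of the ambient space. -/
def IsSmoothOn (f : X → V) (S : Set X) : Prop :=
  ∀ x ∈ S, ∃ U : Set X, IsOpen U ∧ x ∈ U ∧
    ∃ g : X → V, ContDiffOn ℝ ∞ g U ∧ Set.EqOn f g (S ∩ U)

/-- `f` restricts to a smooth embedding of `S`, i.e. to a diffeomorphism of `S` onto `f(S)`:
`f` is smooth on `S`, injective on `S`, and the inverse `f(S) → S` is smooth. -/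
def IsSmoothEmbeddingOn (f : X → V) (S : Set X) : Prop :=
  IsSmoothOn f S ∧ ∃ g : V → X, IsSmoothOn g (f '' S) ∧ Set.LeftInvOn g f S

/-- The finite family `f` restricts to a smooth embedding of the disjoint union of copies of the
compact set `S`, one copy for each index. -/
def IsSmoothEmbeddingFamily {a : ℕ} (f : Fin a → X → V) (S : Set X) : Prop :=
  (∀ i, IsSmoothEmbeddingOn (f i) S) ∧
    Pairwise fun i j => Disjoint (f i '' S) (f j '' S)

end Embeddings

section Diagrams

variable {V : Type*} [NormedAddCommGroup V] [NormedSpace ℝ V]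

/-- `Φ` parametrises trivial `d`-balls of `L`: it embeds a disjoint union of `d`-balls in `V`,
and the union of the boundary spheres is `L`. -/
def IsTrivialBalls {a d : ℕ} (Φ : Fin a → Euc d → V) (L : Set V) : Prop :=
  IsSmoothEmbeddingFamily Φ (unitBall d) ∧ ⋃ i, Φ i '' unitSphere d = L

/-- `L` is a trivial `(d-1)`-link: it bounds disjoint smoothly embedded `d`-balls. -/
def IsTrivialLink (d : ℕ) (L : Set V) : Prop :=
  ∃ (a : ℕ) (Φ : Fin a → Euc d → V), IsTrivialBalls Φ L

/-- `L₁ ∪ L₂` is an `(n,k)`-Kirby diagram in the `(n-1)`-dimensional space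
`V = S^{n-1} ∖ {∞}`, with dotted part `L₁` and framed part `L₂`:
`L₁` is a trivial `(n-k-1)`-link, and a disjoint union of spheres `S^{n-k-1}` and of framed spheres
`S^{k-1} × B^{n-k}` is embedded in `V`, with `L₁` the image of the former and `L₂` the image of
the cores `S^{k-1} × {0}` of the latter. -/
structure IsKirbyDiagram (n k : ℕ) (L₁ L₂ : Set V) : Prop where
  finrank_add_one : Module.finrank ℝ V + 1 = n
  trivial_dotted : IsTrivialLink (n - k) L₁
  exists_embedding : ∃ (a b : ℕ) (φ : Fin a → Euc (n - k) → V)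
    (ψ : Fin b → Euc k × Euc (n - k) → V),
    IsSmoothEmbeddingFamily φ (unitSphere (n - k)) ∧
    IsSmoothEmbeddingFamily ψ (unitSphere k ×ˢ unitBall (n - k)) ∧
    (∀ i j, Disjoint (φ i '' unitSphere (n - k))
      (ψ j '' (unitSphere k ×ˢ unitBall (n - k)))) ∧
    L₁ = ⋃ i, φ i '' unitSphere (n - k) ∧
    L₂ = ⋃ j, ψ j '' (unitSphere k ×ˢ {0})

end Diagrams

/-- With `D : ∐ B² → ℝ³`, the boundary of the thickened disks `B^p × D × {0}` in
`ℝ^p × ℝ³ × ℝ^q` with corners rounded: the thickened disks are taken to be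
`{(u, D(v), 0) : |u|² + |v|² ≤ 1}`. -/
def inducedDotted (p q : ℕ) {a : ℕ} (D : Fin a → Euc 2 → Euc 3) :
    Set (Euc p × Euc 3 × Euc q) :=
  {x | ∃ (i : Fin a) (u : Euc p) (v : Euc 2),
    ‖u‖ ^ 2 + ‖v‖ ^ 2 = 1 ∧ x = (u, D i v, 0)}

/-- With `D : ∐ B² → ℝ^p × ℝ³`, the boundary of the thickened disks `D × B^q` in
`ℝ^p × ℝ³ × ℝ^q` with corners rounded: the thickened disks are taken to be
`{(D(v), w) : |v|² + |w|² ≤ 1}`. -/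
def inducedFramed (p q : ℕ) {b : ℕ} (D : Fin b → Euc 2 → Euc p × Euc 3) :
    Set (Euc p × Euc 3 × Euc q) :=
  {x | ∃ (j : Fin b) (v : Euc 2) (w : Euc q),
    ‖v‖ ^ 2 + ‖w‖ ^ 2 = 1 ∧ x = ((D j v).1, (D j v).2, w)}

end KirbyDiag

/-! Write p = n - k - 2 and q = k - 2; the hypotheses force p ≥ 1. The dotted part needs no work: an
orthogonal splitting of ℝ^(p+2) parametrises the rounded thickening of `D₁` by balls
(`isTrivialBalls_inducedDotted`).

The content is an ambient unlinking of L₂ in ℝ^p × ℝ³, which has at least one spare direction e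
(`exists_unlinking`). Three shears straighten the link. Lift the point with parameter x on component
j to height x₀ + 3j along e. For generic ν, the projection along ν together with this height still
embeds the link, so the ν-coordinate can be changed to x₁. Finally (x₀ + 3j, x₁) determines the
point, so the remaining coordinates can be moved to 0. The result is a row of round circles in the
plane of e and ν; pulling back the flat disks they bound gives `D₂`.

The same diffeomorphism, times the identity of ℝ^q, takes the framed part to round spheres. These
have explicit thin framings, which are transported back. The two parts are disjoint even if the
disks meet: a common point has w = 0, hence lies over ∂`D₂`, hence has u = 0, and L₁ and L₂ are
disjoint. -/

namespace KirbyDiag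

open Set Topology

/-! ### Smooth maps and embeddings on subsets -/

section SmoothOn

variable {X V W Z : Type*} [NormedAddCommGroup X] [NormedSpace ℝ X]
  [NormedAddCommGroup V] [NormedSpace ℝ V] [NormedAddCommGroup W] [NormedSpace ℝ W]
  [NormedAddCommGroup Z] [NormedSpace ℝ Z]

lemma IsSmoothOn.of_contDiffOn {f : X → V} {S : Set X}
    (h : ∀ x ∈ S, ∃ U : Set X, IsOpen U ∧ x ∈ U ∧ ContDiffOn ℝ ∞ f U) : IsSmoothOn f S :=
  fun x hx ↦ let ⟨U, hU, hxU, hf⟩ := h x hx; ⟨U, hU, hxU, f, hf, fun _ _ ↦ rfl⟩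

lemma _root_.ContDiff.isSmoothOn {f : X → V} (hf : ContDiff ℝ ∞ f) (S : Set X) : IsSmoothOn f S :=
  .of_contDiffOn fun _ _ ↦ ⟨univ, isOpen_univ, mem_univ _, hf.contDiffOn⟩

lemma IsSmoothOn.mono {f : X → V} {S T : Set X} (hf : IsSmoothOn f T) (h : S ⊆ T) :
    IsSmoothOn f S := fun x hx ↦
  let ⟨U, hU, hxU, g, hg, hfg⟩ := hf x (h hx)
  ⟨U, hU, hxU, g, hg, hfg.mono (inter_subset_inter_left _ h)⟩

lemma IsSmoothOn.congr {f g : X → V} {S : Set X} (hf : IsSmoothOn f S) (h : EqOn g f S) :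
    IsSmoothOn g S := fun x hx ↦
  let ⟨U, hU, hxU, f', hf', hff'⟩ := hf x hx
  ⟨U, hU, hxU, f', hf', fun _ hy ↦ (h hy.1).trans (hff' hy)⟩

lemma IsSmoothOn.comp {f : X → V} {g : V → W} {S : Set X} {T : Set V} (hg : IsSmoothOn g T)
    (hf : IsSmoothOn f S) (h : MapsTo f S T) : IsSmoothOn (g ∘ f) S := by
  intro x hx
  obtain ⟨U, hU, hxU, f', hf', hff'⟩ := hf x hx
  obtain ⟨U₁, hU₁, hxU₁, g', hg', hgg'⟩ := hg (f x) (h hx)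
  refine ⟨U ∩ f' ⁻¹' U₁, hf'.continuousOn.isOpen_inter_preimage hU hU₁, ⟨hxU, ?_⟩, g' ∘ f',
    hg'.comp (hf'.mono inter_subset_left) fun _ hy ↦ hy.2, ?_⟩
  · rw [mem_preimage, ← hff' ⟨hx, hxU⟩]
    exact hxU₁
  · rintro y ⟨hy, hyU, hyU₁⟩
    have e := hff' ⟨hy, hyU⟩
    simp only [Function.comp_apply, ← e]
    exact hgg' ⟨h hy, by rw [e]; exact hyU₁⟩

lemma IsSmoothOn.prodMk {f : X → V} {g : X → W} {S : Set X} (hf : IsSmoothOn f S)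
    (hg : IsSmoothOn g S) : IsSmoothOn (fun x ↦ (f x, g x)) S := by
  intro x hx
  obtain ⟨U, hU, hxU, f', hf', hff'⟩ := hf x hx
  obtain ⟨U₁, hU₁, hxU₁, g', hg', hgg'⟩ := hg x hx
  refine ⟨U ∩ U₁, hU.inter hU₁, ⟨hxU, hxU₁⟩, fun y ↦ (f' y, g' y),
    (hf'.mono inter_subset_left).prodMk (hg'.mono inter_subset_right), ?_⟩
  rintro y ⟨hy, hyU, hyU₁⟩
  exact Prod.ext (hff' ⟨hy, hyU⟩) (hgg' ⟨hy, hyU₁⟩)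

lemma IsSmoothOn.continuousOn {f : X → V} {S : Set X} (hf : IsSmoothOn f S) :
    ContinuousOn f S := by
  intro x hx
  obtain ⟨U, hU, hxU, g, hg, hfg⟩ := hf x hx
  have h : ContinuousWithinAt g (S ∩ U) x :=
    (hg.continuousOn.continuousAt (hU.mem_nhds hxU)).continuousWithinAt
  exact (continuousWithinAt_inter (hU.mem_nhds hxU)).1 (h.congr hfg (hfg ⟨hx, hxU⟩))

lemma IsSmoothEmbeddingOn.injOn {f : X → V} {S : Set X} (hf : IsSmoothEmbeddingOn f S) :
    InjOn f S :=
  let ⟨_, _, _, h⟩ := hf; h.injOn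

lemma IsSmoothEmbeddingOn.mono {f : X → V} {S T : Set X} (hf : IsSmoothEmbeddingOn f T)
    (h : S ⊆ T) : IsSmoothEmbeddingOn f S :=
  let ⟨hs, g, hg, hgf⟩ := hf
  ⟨hs.mono h, g, hg.mono (image_mono h), hgf.mono h⟩

lemma IsSmoothEmbeddingOn.comp {f : X → V} {g : V → W} {S : Set X} {T : Set V}
    (hg : IsSmoothEmbeddingOn g T) (hf : IsSmoothEmbeddingOn f S) (h : MapsTo f S T) :
    IsSmoothEmbeddingOn (g ∘ f) S := by
  obtain ⟨hs, f', hf', hff'⟩ := hf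
  obtain ⟨ht, g', hg', hgg'⟩ := hg
  refine ⟨ht.comp hs h, f' ∘ g', hf'.comp (hg'.mono ?_) ?_, fun x hx ↦ ?_⟩
  · rw [image_comp]
    exact image_mono h.image_subset
  · rintro _ ⟨x, hx, rfl⟩
    exact ⟨x, hx, (hgg' (h hx)).symm⟩
  · simp [hgg' (h hx), hff' hx]

lemma isSmoothEmbeddingOn_of_leftInverse {f : X → V} {g : V → X} (hf : ContDiff ℝ ∞ f)
    (hg : ContDiff ℝ ∞ g) (h : Function.LeftInverse g f) (S : Set X) : IsSmoothEmbeddingOn f S :=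
  ⟨hf.isSmoothOn S, g, hg.isSmoothOn _, fun x _ ↦ h x⟩

lemma IsSmoothEmbeddingFamily.mono {a : ℕ} {f : Fin a → X → V} {S T : Set X}
    (hf : IsSmoothEmbeddingFamily f T) (h : S ⊆ T) : IsSmoothEmbeddingFamily f S :=
  ⟨fun i ↦ (hf.1 i).mono h, fun _ _ hij ↦ (hf.2 hij).mono (image_mono h) (image_mono h)⟩

/-- Smooth functions prescribed on the members of a compact embedded family extend to the ambient
space. -/
lemma IsSmoothEmbeddingFamily.exists_contDiff_extension [FiniteDimensional ℝ V] {a : ℕ}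
    {f : Fin a → X → V} {S : Set X} (hS : IsCompact S) (hf : IsSmoothEmbeddingFamily f S)
    {w : Fin a → X → W} (hw : ∀ i, IsSmoothOn (w i) S) :
    ∃ h : V → W, ContDiff ℝ ∞ h ∧ ∀ i, ∀ x ∈ S, h (f i x) = w i x := by
  have hcl : ∀ i, IsClosed (f i '' S) := fun i ↦
    (hS.image_of_continuousOn (hf.1 i).1.continuousOn).isClosed
  -- Over a point of the image this is a single value, elsewhere all of `W`. It is always convex, so
  -- a partition of unity glues local solutions.
  let t : V → Set W := fun y ↦ {z | ∀ i, ∀ x ∈ S, f i x = y → z = w i x}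
  have ht : ∀ y, Convex ℝ (t y) := by
    intro y z hz z' hz' α β _ _ hαβ i x hx hxy
    rw [hz i x hx hxy, hz' i x hx hxy, ← add_smul, hαβ, one_smul]
  obtain ⟨h, hh⟩ := exists_contMDiffMap_forall_mem_convex_of_local (n := ⊤)
    (modelWithCornersSelf ℝ V) (t := t) ht (by
      intro y
      by_cases hy : ∃ i, y ∈ f i '' S
      · obtain ⟨i, hy⟩ := hy
        obtain ⟨-, g, hg, hgf⟩ := hf.1 i
        have hwg : IsSmoothOn (w i ∘ g) (f i '' S) := (hw i).comp hg (by
          rintro _ ⟨x, hx, rfl⟩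
          rwa [hgf hx])
        obtain ⟨U, hU, hyU, g', hg', hgg'⟩ := hwg y hy
        refine ⟨U ∩ ⋂ j ∈ {j | j ≠ i}, (f j '' S)ᶜ, Filter.inter_mem (hU.mem_nhds hyU) ?_, g',
          (hg'.mono inter_subset_left).contMDiffOn, ?_⟩
        · rw [Filter.biInter_mem (Set.toFinite _)]
          intro j hj
          exact (hcl j).isOpen_compl.mem_nhds fun hy' ↦ disjoint_left.1 (hf.2 hj) hy' hy
        · rintro z ⟨hzU, hz⟩ j x hx rfl
          have hji : j = i := by
            by_contra hji
            exact mem_iInter₂.1 hz j hji ⟨x, hx, rfl⟩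
          subst hji
          rw [← hgg' ⟨⟨x, hx, rfl⟩, hzU⟩, Function.comp_apply, hgf hx]
      · refine ⟨⋂ i, (f i '' S)ᶜ, ?_, fun _ ↦ 0, contMDiffOn_const, ?_⟩
        · rw [Filter.iInter_mem]
          exact fun i ↦ (hcl i).isOpen_compl.mem_nhds fun h ↦ hy ⟨i, h⟩
        · rintro z hz j x hx rfl
          exact absurd ⟨x, hx, rfl⟩ (mem_iInter.1 hz j))
  exact ⟨h, h.contMDiff.contDiff, fun i x hx ↦ hh (f i x) i x hx rfl⟩

lemma IsSmoothOn.exists_contDiff_extension [FiniteDimensional ℝ X] {f : X → V} {S : Set X}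
    (hS : IsCompact S) (hf : IsSmoothOn f S) : ∃ g : X → V, ContDiff ℝ ∞ g ∧ EqOn g f S := by
  have hid : IsSmoothEmbeddingFamily (fun _ : Fin 1 ↦ (id : X → X)) S :=
    ⟨fun _ ↦ isSmoothEmbeddingOn_of_leftInverse contDiff_id contDiff_id (fun _ ↦ rfl) S,
      fun i j hij ↦ (hij (Subsingleton.elim i j)).elim⟩
  obtain ⟨g, hg, h⟩ := hid.exists_contDiff_extension hS (w := fun _ ↦ f) fun _ ↦ hf
  exact ⟨g, hg, h 0⟩

/-- The inverse function theorem, arranged to give a local inverse that is C^∞ on a whole open set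
and not only at one point. -/
lemma exists_smooth_localInverse [CompleteSpace X] {f : X → X} (hf : ContDiff ℝ ∞ f) {x : X}
    {e : X ≃L[ℝ] X} (hx : HasFDerivAt f (e : X →L[ℝ] X) x) :
    ∃ N U : Set X, IsOpen N ∧ IsOpen U ∧ x ∈ N ∧ f x ∈ U ∧
      ∃ h : X → X, ContDiffOn ℝ ∞ h U ∧ ∀ y ∈ N, h (f y) = y := by
  let E := hf.contDiffAt.toOpenPartialHomeomorph f hx (by simp)
  have hE : ∀ y, E y = f y := fun y ↦ rfl
  have hxE : x ∈ E.source := hf.contDiffAt.mem_toOpenPartialHomeomorph_source hx (by simp)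
  have hd : Continuous (fderiv ℝ f) := hf.continuous_fderiv (by simp)
  -- The local inverse is smooth at each point over which the derivative is invertible, and
  -- invertibility is an open condition.
  let O : Set X := fderiv ℝ f ⁻¹' range ((↑) : (X ≃L[ℝ] X) → X →L[ℝ] X)
  have hO : IsOpen O := (ContinuousLinearEquiv.isOpen (𝕜 := ℝ) (E := X) (F := X)).preimage hd
  refine ⟨E.source, E.target ∩ E.symm ⁻¹' O, E.open_source, E.isOpen_inter_preimage_symm hO, hxE,
    ⟨E.map_source hxE, ?_⟩, E.symm, ?_, fun y hy ↦ E.left_inv hy⟩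
  · rw [mem_preimage, ← hE, E.left_inv hxE]
    exact ⟨e, hx.fderiv.symm⟩
  · rintro y ⟨hy, e', he'⟩
    refine (E.contDiffAt_symm (f₀' := e') hy ?_ hf.contDiffAt).contDiffWithinAt
    rw [he']
    exact (hf.differentiable (by simp) _).hasFDerivAt

/-- An injective map from a compact subset of a level set of `c`, immersive on the level set,
is a smooth embedding. -/
lemma isSmoothEmbeddingOn_of_injOn_of_fderiv [FiniteDimensional ℝ X]
    [FiniteDimensional ℝ V] [FiniteDimensional ℝ Z] {f : X → V}
    {S : Set X} {c : X → Z} {z : Z} (hS : IsCompact S) (hf : ContDiff ℝ ∞ f) (hc : ContDiff ℝ ∞ c)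
    (hcS : ∀ x ∈ S, c x = z) (hinj : InjOn f S)
    (hd : ∀ x ∈ S, ∀ v, fderiv ℝ f x v = 0 → fderiv ℝ c x v = 0 → v = 0) :
    IsSmoothEmbeddingOn f S := by
  refine ⟨hf.isSmoothOn S, Function.invFunOn f S, ?_, hinj.leftInvOn_invFunOn⟩
  rintro _ ⟨x, hx, rfl⟩
  have hfc : ContDiff ℝ ∞ fun y ↦ (f y, c y) := hf.prodMk hc
  have hD : HasFDerivAt (fun y ↦ (f y, c y)) ((fderiv ℝ f x).prod (fderiv ℝ c x)) x :=
    (hf.differentiable (by simp) x).hasFDerivAt.prodMk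
      (hc.differentiable (by simp) x).hasFDerivAt
  -- The pair (f, c) is immersive at x, so composing it with a linear left inverse of its derivative
  -- gives a local diffeomorphism of `X`. As c = z on `S`, its inverse yields a smooth inverse of f
  -- through y ↦ A (y, z).
  obtain ⟨A, hA⟩ : ∃ A : V × Z →L[ℝ] X,
      A.comp ((fderiv ℝ f x).prod (fderiv ℝ c x)) = ContinuousLinearMap.id ℝ X := by
    have hi : Function.Injective ((fderiv ℝ f x).prod (fderiv ℝ c x)) := by
      refine (injective_iff_map_eq_zero _).2 fun v hv ↦ ?_
      exact hd x hx v (congrArg Prod.fst hv) (congrArg Prod.snd hv)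
    obtain ⟨A, hA⟩ := ContinuousLinearMap.HasLeftInverse.of_injective_of_finiteDimensional hi
    exact ⟨A, ContinuousLinearMap.ext hA⟩
  obtain ⟨N, U, hN, hU, hxN, hxU, h, hh, hhN⟩ := exists_smooth_localInverse
    (f := fun y ↦ A (f y, c y)) (x := x) (e := .refl ℝ X) (A.contDiff.comp hfc) (by
      have := A.hasFDerivAt.comp x hD
      rw [hA] at this
      exact this)
  have hcl : IsClosed (f '' (S \ N)) :=
    ((hS.diff hN).image_of_continuousOn hf.continuous.continuousOn).isClosed
  have hi : ContDiff ℝ ∞ fun y : V ↦ A (y, z) := A.contDiff.comp (contDiff_id.prodMk contDiff_const)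
  -- Removing the compact set f(S \ N) leaves only image points coming from `N`, where the local
  -- inverse is valid.
  refine ⟨(f '' (S \ N))ᶜ ∩ (fun y ↦ A (y, z)) ⁻¹' U,
    hcl.isOpen_compl.inter (hU.preimage hi.continuous), ⟨?_, ?_⟩, fun y ↦ h (A (y, z)),
    hh.comp hi.contDiffOn fun y hy ↦ hy.2, ?_⟩
  · rintro ⟨y, hy, hyx⟩
    exact hy.2 (hinj hy.1 hx hyx ▸ hxN)
  · rwa [mem_preimage, ← hcS x hx]
  · rintro _ ⟨⟨y, hy, rfl⟩, hyN, -⟩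
    have hyN' : y ∈ N := by
      by_contra hn
      exact hyN ⟨y, ⟨hy, hn⟩, rfl⟩
    simp only
    rw [hinj.leftInvOn_invFunOn hy, ← hcS y hy]
    exact (hhN y hyN').symm

end SmoothOn

/-! ### Plane coordinates and separated strips -/

/-- Spacing 3 puts unit disks centred at 3j in disjoint strips of half-width 3/2; this is how
distinct components are kept apart throughout. -/
lemma eq_of_abs_sub_three_mul_lt {b : ℕ} {i j : Fin b} {r : ℝ} (hi : |r - 3 * i| < 3 / 2)
    (hj : |r - 3 * j| < 3 / 2) : i = j := by
  rw [abs_lt] at hi hj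
  have h₁ : (i : ℝ) < j + 1 := by linarith
  have h₂ : (j : ℝ) < i + 1 := by linarith
  have h₁' : (i : ℕ) < j + 1 := by exact_mod_cast h₁
  have h₂' : (j : ℕ) < i + 1 := by exact_mod_cast h₂
  exact Fin.ext (by omega)

lemma abs_add_three_mul_sub_lt {x : Euc 2} (hx : ‖x‖ ≤ 1) (r : ℝ) :
    |x 0 + 3 * r - 3 * r| < 3 / 2 := by
  have := (PiLp.norm_apply_le x 0).trans hx
  rw [Real.norm_eq_abs] at this
  rw [add_sub_cancel_right]
  linarith

/-- The point `(r, s)` of the plane. -/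
noncomputable def pt (r s : ℝ) : Euc 2 :=
  r • EuclideanSpace.single 0 1 + s • EuclideanSpace.single 1 1

@[simp] lemma pt_zero (r s : ℝ) : pt r s 0 = r := by simp [pt]

@[simp] lemma pt_one (r s : ℝ) : pt r s 1 = s := by simp [pt]

lemma pt_eta (x : Euc 2) : pt (x 0) (x 1) = x := by
  ext i
  fin_cases i <;> simp

@[fun_prop] lemma contDiff_pt {X : Type*} [NormedAddCommGroup X] [NormedSpace ℝ X] {n : ℕ∞ω}
    {f g : X → ℝ} (hf : ContDiff ℝ n f) (hg : ContDiff ℝ n g) :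
    ContDiff ℝ n fun x ↦ pt (f x) (g x) :=
  (hf.smul contDiff_const).add (hg.smul contDiff_const)

lemma hasDerivAt_pt {f g : ℝ → ℝ} {f' g' t : ℝ} (hf : HasDerivAt f f' t)
    (hg : HasDerivAt g g' t) : HasDerivAt (fun t ↦ pt (f t) (g t)) (pt f' g') t :=
  (hf.smul_const _).add (hg.smul_const _)

lemma norm_sq_eq_two (x : Euc 2) : ‖x‖ ^ 2 = x 0 ^ 2 + x 1 ^ 2 := by
  simp [EuclideanSpace.norm_sq_eq]

lemma mem_unitSphere_two {x : Euc 2} : x ∈ unitSphere 2 ↔ x 0 ^ 2 + x 1 ^ 2 = 1 := by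
  rw [← norm_sq_eq_two, mem_sphere_zero_iff_norm]
  exact (pow_eq_one_iff_of_nonneg (norm_nonneg x) two_ne_zero).symm

lemma exists_angle {x : Euc 2} (hx : x ∈ unitSphere 2) :
    ∃ θ : ℝ, x = pt (Real.cos θ) (Real.sin θ) := by
  rw [mem_unitSphere_two] at hx
  obtain ⟨θ, hθ⟩ := (Complex.norm_eq_one_iff ⟨x 0, x 1⟩).1 (by
    rw [Complex.norm_def, Complex.normSq_mk, ← sq, ← sq, hx, Real.sqrt_one])
  refine ⟨θ, ?_⟩
  rw [← pt_eta x]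
  have h₀ := congrArg Complex.re hθ
  have h₁ := congrArg Complex.im hθ
  rw [Complex.exp_ofReal_mul_I_re] at h₀
  rw [Complex.exp_ofReal_mul_I_im] at h₁
  simp only at h₀ h₁
  rw [h₀, h₁]

/-! ### Generic directions, shears and circles -/

section Linear

variable {X V Y : Type*} [NormedAddCommGroup X] [NormedSpace ℝ X]
  [NormedAddCommGroup V] [NormedSpace ℝ V]
  [NormedAddCommGroup Y] [NormedSpace ℝ Y]

lemma IsSmoothEmbeddingFamily.congr {a : ℕ} {f g : Fin a → X → V} {S : Set X}
    (hf : IsSmoothEmbeddingFamily f S) (h : ∀ i, EqOn (g i) (f i) S) :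
    IsSmoothEmbeddingFamily g S := by
  refine ⟨fun i ↦ ⟨(hf.1 i).1.congr (h i), ?_⟩, fun i j hij ↦ ?_⟩
  · obtain ⟨-, k, hk, hkf⟩ := hf.1 i
    refine ⟨k, (h i).image_eq ▸ hk, fun x hx ↦ ?_⟩
    rw [h i hx, hkf hx]
  · simpa only [(h i).image_eq, (h j).image_eq] using hf.2 hij

/-- Countably many smooth surfaces do not fill a space of dimension at least three. -/
lemma exists_ne_zero_forall_ne [FiniteDimensional ℝ Y] (hY : 2 < Module.finrank ℝ Y)
    {ι : Type*} [Countable ι] {A : ι → ℝ × ℝ → Y} (hA : ∀ i, ContDiff ℝ 1 (A i)) :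
    ∃ ν : Y, ν ≠ 0 ∧ ∀ i z, A i z ≠ ν := by
  have h : dimH (⋃ i, range (A i)) ≤ 2 := by
    rw [dimH_iUnion]
    refine iSup_le fun i ↦ (hA i).dimH_range_le.trans ?_
    simp
  have hd : Dense (⋃ i, range (A i))ᶜ :=
    dense_compl_of_dimH_lt_finrank (h.trans_lt (by exact_mod_cast hY))
  have : Nontrivial Y := Module.nontrivial_of_finrank_pos (R := ℝ) (by omega)
  obtain ⟨ν, hν, hν'⟩ := hd.inter_open_nonempty {0}ᶜ isOpen_compl_singleton (exists_ne 0)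
  exact ⟨ν, hν, fun i z hz ↦ hν' (mem_iUnion.2 ⟨i, z, hz⟩)⟩

/-- A displacement that is constant along the lines it spans gives a diffeomorphism. -/
lemma exists_shear {s : V → V} (hs : ContDiff ℝ ∞ s) (h₁ : ∀ z, s (z + s z) = s z)
    (h₂ : ∀ z, s (z - s z) = s z) :
    ∃ T : V ≃ V, ContDiff ℝ ∞ T ∧ ContDiff ℝ ∞ T.symm ∧ ∀ z, T z = z + s z :=
  ⟨⟨fun z ↦ z + s z, fun z ↦ z - s z, fun z ↦ by simp [h₁], fun z ↦ by simp [h₂]⟩,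
    contDiff_id.add hs, contDiff_id.sub hs, fun _ ↦ rfl⟩

lemma isSmoothEmbeddingFamily_standardCircles (b : ℕ) :
    IsSmoothEmbeddingFamily (fun (j : Fin b) (x : Euc 2) ↦ (x 0 + 3 * j, x 1)) (unitSphere 2) := by
  refine ⟨fun j ↦ isSmoothEmbeddingOn_of_leftInverse (g := fun z ↦ pt (z.1 - 3 * j) z.2)
    (by fun_prop) (by fun_prop) (fun x ↦ by simp [pt_eta]) _, fun i j hij ↦ ?_⟩
  refine disjoint_left.2 ?_
  rintro _ ⟨x, hx, rfl⟩ ⟨y, hy, hxy⟩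
  have h := abs_add_three_mul_sub_lt (mem_sphere_zero_iff_norm.1 hy).le j
  have hxy' : y 0 + 3 * j = x 0 + 3 * (i : ℝ) := congrArg Prod.fst hxy
  rw [hxy'] at h
  exact hij (eq_of_abs_sub_three_mul_lt
    (abs_add_three_mul_sub_lt (mem_sphere_zero_iff_norm.1 hx).le i) h)

/-- The smooth inverse on the image recovers the circle, so by the chain rule the velocity cannot
vanish. Only (±1, 0) matter: there the first coordinate is critical on the circle. -/
lemma fderiv_pt_zero_one_ne_zero [FiniteDimensional ℝ Y] {γ : Euc 2 → Y} (hγ : ContDiff ℝ ∞ γ)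
    (h : IsSmoothEmbeddingOn γ (unitSphere 2)) {s : ℝ} (hs : s ^ 2 = 1) :
    fderiv ℝ γ (pt s 0) (pt 0 1) ≠ 0 := by
  obtain ⟨-, ρ, hρ, hργ⟩ := h
  have hS : IsCompact (γ '' unitSphere 2) := (isCompact_sphere 0 1).image hγ.continuous
  obtain ⟨ρ', hρ', hρρ'⟩ := hρ.exists_contDiff_extension hS
  have hc : HasDerivAt (fun θ ↦ pt (s * Real.cos θ) (Real.sin θ)) (pt 0 1) 0 := by
    have := hasDerivAt_pt ((Real.hasDerivAt_cos 0).const_mul s) (Real.hasDerivAt_sin 0)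
    simpa using this
  have h0 : pt (s * Real.cos 0) (Real.sin 0) = pt s 0 := by simp
  have hmem : ∀ θ, pt (s * Real.cos θ) (Real.sin θ) ∈ unitSphere 2 := fun θ ↦ by
    rw [mem_unitSphere_two, pt_zero, pt_one, mul_pow, hs, one_mul, Real.cos_sq_add_sin_sq]
  have h₁ : HasDerivAt (fun θ ↦ γ (pt (s * Real.cos θ) (Real.sin θ)))
      (fderiv ℝ γ (pt s 0) (pt 0 1)) 0 :=
    HasFDerivAt.comp_hasDerivAt (f := fun θ ↦ pt (s * Real.cos θ) (Real.sin θ)) 0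
      (h0 ▸ (hγ.differentiable (by simp) _).hasFDerivAt) hc
  have h₂ : HasDerivAt (fun θ ↦ ρ' (γ (pt (s * Real.cos θ) (Real.sin θ))))
      (fderiv ℝ ρ' (γ (pt s 0)) (fderiv ℝ γ (pt s 0) (pt 0 1))) 0 :=
    HasFDerivAt.comp_hasDerivAt (f := fun θ ↦ γ (pt (s * Real.cos θ) (Real.sin θ))) 0
      (h0 ▸ (hρ'.differentiable (by simp) _).hasFDerivAt) h₁
  have h₃ : (fun θ ↦ ρ' (γ (pt (s * Real.cos θ) (Real.sin θ)))) =
      fun θ ↦ pt (s * Real.cos θ) (Real.sin θ) :=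
    funext fun θ ↦ (hρρ' ⟨_, hmem θ, rfl⟩).trans (hργ (hmem θ))
  intro hz
  rw [h₃, hz, map_zero] at h₂
  have := congrArg (fun x : Euc 2 ↦ x 1) (hc.unique h₂)
  simp at this

end Linear

/-! ### Unlinking in one extra dimension -/

section Unlinking

variable {E Y : Type*} [NormedAddCommGroup E] [NormedSpace ℝ E]
  [NormedAddCommGroup Y] [NormedSpace ℝ Y]

/-- The projection of `Y` along `ν` onto the kernel of `ℓ`, when `ℓ ν = 1`. -/
noncomputable def projAlong (ℓ : Y →L[ℝ] ℝ) (ν : Y) : Y →L[ℝ] Y :=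
  ContinuousLinearMap.id ℝ Y - ℓ.smulRight ν

@[simp] lemma projAlong_apply (ℓ : Y →L[ℝ] ℝ) (ν y : Y) : projAlong ℓ ν y = y - ℓ y • ν := rfl

/-- For a generic direction `ν`, a link projects along `ν` with double points at which the
first coordinates of the parameters differ. -/
lemma IsSmoothEmbeddingFamily.exists_generic_direction [FiniteDimensional ℝ Y]
    (hY : 2 < Module.finrank ℝ Y) {b : ℕ} {γ : Fin b → Euc 2 → Y} (hγ : ∀ j, ContDiff ℝ ∞ (γ j))
    (hemb : IsSmoothEmbeddingFamily γ (unitSphere 2)) :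
    ∃ ν : Y, ν ≠ 0 ∧ ∀ ℓ : Y →L[ℝ] ℝ, ℓ ν = 1 → IsSmoothEmbeddingFamily
      (fun j x ↦ (projAlong ℓ ν (γ j x), x 0 + 3 * j)) (unitSphere 2) := by
  -- Two kinds of bad direction: chords joining points of equal first coordinate (reflected
  -- parameters), and tangents at (±1, 0). The scalar and the angle make these surfaces; in the
  -- second kind the angle is a dummy and the integer index is used only at ±1.
  obtain ⟨ν, hν, hA⟩ := exists_ne_zero_forall_ne hY (ι := Fin b ⊕ Fin b × ℤ)
    (A := Sum.elim
      (fun j z ↦ z.1 • (γ j (pt (Real.cos z.2) (Real.sin z.2)) -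
        γ j (pt (Real.cos z.2) (-Real.sin z.2))))
      (fun i z ↦ z.1 • fderiv ℝ (γ i.1) (pt i.2 0) (pt 0 1))) (by
    have hγ' : ∀ j, ContDiff ℝ 1 (γ j) := fun j ↦ (hγ j).of_le (by simp)
    rintro (j | i) <;> simp only [Sum.elim_inl, Sum.elim_inr]
    · refine contDiff_fst.smul (((hγ' j).comp ?_).sub ((hγ' j).comp ?_))
      · exact contDiff_pt (Real.contDiff_cos.comp contDiff_snd)
          (Real.contDiff_sin.comp contDiff_snd)
      · exact contDiff_pt (Real.contDiff_cos.comp contDiff_snd)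
          (Real.contDiff_sin.comp contDiff_snd).neg
    · exact contDiff_fst.smul contDiff_const)
  refine ⟨ν, hν, fun ℓ hℓ ↦ ⟨fun j ↦ ?_, fun i j hij ↦ ?_⟩⟩
  · have hP : ∀ y : Y, projAlong ℓ ν y = 0 → y ≠ 0 → ∃ t : ℝ, t • y = ν := by
      intro y hy hy0
      rw [projAlong_apply, sub_eq_zero] at hy
      have : ℓ y ≠ 0 := fun h ↦ hy0 (by rw [hy, h, zero_smul])
      refine ⟨(ℓ y)⁻¹, ?_⟩
      nth_rw 2 [hy]
      rw [smul_smul, inv_mul_cancel₀ this, one_smul]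
    refine isSmoothEmbeddingOn_of_injOn_of_fderiv (c := fun x ↦ ‖x‖ ^ 2) (z := 1)
      (isCompact_sphere 0 1) (by have := hγ j; fun_prop) (contDiff_norm_sq ℝ)
      (fun x hx ↦ by rw [mem_sphere_zero_iff_norm.1 hx, one_pow]) ?_ ?_
    · intro x hx y hy hxy
      obtain ⟨h₁, h₂⟩ := Prod.ext_iff.1 hxy
      simp only [add_left_inj] at h₁ h₂
      by_contra hne
      have hx' := mem_unitSphere_two.1 hx
      have hy' := mem_unitSphere_two.1 hy
      have h₃ : y 1 = -x 1 := by
        have : (y 1 - x 1) * (y 1 + x 1) = 0 := by rw [h₂] at hx'; linarith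
        rcases mul_eq_zero.1 this with h | h
        · exact (hne (by rw [← pt_eta x, ← pt_eta y, h₂, sub_eq_zero.1 h])).elim
        · linarith
      obtain ⟨θ, rfl⟩ := exists_angle hx
      have hy₀ : y = pt (Real.cos θ) (-Real.sin θ) := by
        rw [← pt_eta y, h₃, ← h₂, pt_zero, pt_one]
      obtain ⟨t, ht⟩ := hP (γ j (pt (Real.cos θ) (Real.sin θ)) - γ j y)
        (by rw [map_sub, h₁, sub_self]) (sub_ne_zero.2 ((hemb.1 j).injOn.ne hx hy hne))
      exact hA (.inl j) (t, θ) (by simpa [← hy₀] using ht)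
    · intro x hx v hv hc
      have hf : HasFDerivAt (fun x : Euc 2 ↦ (projAlong ℓ ν (γ j x), x 0 + 3 * (j : ℝ)))
          (((projAlong ℓ ν).comp (fderiv ℝ (γ j) x)).prod (EuclideanSpace.proj 0)) x := by
        refine HasFDerivAt.prodMk ?_ ?_
        · exact (projAlong ℓ ν).hasFDerivAt.comp x
            ((hγ j).differentiable (by simp) x).hasFDerivAt
        · exact (EuclideanSpace.proj (𝕜 := ℝ) (0 : Fin 2)).hasFDerivAt.add_const _
      rw [hf.fderiv] at hv
      obtain ⟨h₁, h₂⟩ := Prod.ext_iff.1 hv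
      have h₁' : projAlong ℓ ν (fderiv ℝ (γ j) x v) = 0 := h₁
      have h₂' : v 0 = 0 := h₂
      -- A vector tangent to the circle with zero first component vanishes unless the base point is
      -- (±1, 0).
      rw [fderiv_norm_sq_apply] at hc
      have h₃ : x 1 * v 1 = 0 := by
        simpa [PiLp.inner_apply, h₂', mul_comm] using hc
      have hv' : v = v 1 • pt 0 1 := by
        rw [← pt_eta v, h₂']
        simp [pt]
      rcases mul_eq_zero.1 h₃ with hx₁ | hv₁
      · have hx₀ := mem_unitSphere_two.1 hx
        rw [hx₁, zero_pow two_ne_zero, add_zero] at hx₀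
        obtain ⟨m, hm⟩ : ∃ m : ℤ, x = pt m 0 := by
          rcases sq_eq_one_iff.1 hx₀ with h | h
          · exact ⟨1, by rw [← pt_eta x, h, hx₁]; simp⟩
          · exact ⟨-1, by rw [← pt_eta x, h, hx₁]; simp⟩
        by_contra hv0
        have hd : fderiv ℝ (γ j) x v ≠ 0 := by
          rw [hv', map_smul]
          refine smul_ne_zero (fun h ↦ hv0 (by rw [hv', h, zero_smul])) ?_
          rw [← pt_eta x, hx₁]
          exact fderiv_pt_zero_one_ne_zero (hγ j) (hemb.1 j) hx₀
        obtain ⟨t, ht⟩ := hP _ h₁' hd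
        refine hA (.inr (j, m)) (t * v 1, 0) ?_
        rw [hv', map_smul, smul_smul, hm] at ht
        exact ht
      · rw [hv', hv₁, zero_smul]
  · refine disjoint_left.2 ?_
    rintro _ ⟨x, hx, rfl⟩ ⟨y, hy, hxy⟩
    have h := abs_add_three_mul_sub_lt (mem_sphere_zero_iff_norm.1 hy).le j
    have hxy' : y 0 + 3 * j = x 0 + 3 * (i : ℝ) := congrArg Prod.snd hxy
    rw [hxy'] at h
    exact hij (eq_of_abs_sub_three_mul_lt
      (abs_add_three_mul_sub_lt (mem_sphere_zero_iff_norm.1 hx).le i) h)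

/-- A link in a space of dimension at least three becomes, by a diffeomorphism of the product with
a line (or a larger space), a standard unlink of round circles in a plane. -/
lemma IsSmoothEmbeddingFamily.exists_unlinking [FiniteDimensional ℝ E] [FiniteDimensional ℝ Y]
    (hY : 2 < Module.finrank ℝ Y) {e : E} {η : E →L[ℝ] ℝ} (he : η e = 1) {b : ℕ}
    {γ : Fin b → Euc 2 → Y} (hemb : IsSmoothEmbeddingFamily γ (unitSphere 2)) :
    ∃ F : (E × Y) ≃ (E × Y), ContDiff ℝ ∞ F ∧ ContDiff ℝ ∞ F.symm ∧ ∃ ν : Y, ν ≠ 0 ∧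
      ∀ j, ∀ x ∈ unitSphere 2, F (0, γ j x) = ((x 0 + 3 * j) • e, x 1 • ν) := by
  have hS : IsCompact (unitSphere 2) := isCompact_sphere 0 1
  choose γ' hγ' hγγ' using fun j ↦ (hemb.1 j).1.exists_contDiff_extension hS
  obtain ⟨ν, hν, hemb'⟩ := (hemb.congr hγγ').exists_generic_direction hY hγ'
  obtain ⟨ℓ, hℓ⟩ := SeparatingDual.exists_eq_one (R := ℝ) hν
  have hPν : projAlong ℓ ν ν = 0 := by simp [hℓ]
  obtain ⟨h, hh, hhγ⟩ := hemb.exists_contDiff_extension hS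
    (w := fun (j : Fin b) x ↦ x 0 + 3 * (j : ℝ)) fun j ↦ ContDiff.isSmoothOn (by fun_prop) _
  obtain ⟨g, hg, hgγ⟩ := (hemb' ℓ hℓ).exists_contDiff_extension hS
    (w := fun j x ↦ x 1 - ℓ (γ' j x)) fun j ↦
      ContDiff.isSmoothOn (by have := hγ' j; fun_prop) _
  obtain ⟨k, hk, hkγ⟩ := (isSmoothEmbeddingFamily_standardCircles b).exists_contDiff_extension hS
    (w := fun j x ↦ γ' j x) fun j ↦ (hγ' j).isSmoothOn _
  -- Each displacement depends only on coordinates that its own shear leaves fixed. The three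
  -- correct, in turn, the e-, the ν- and the remaining coordinates.
  obtain ⟨F₁, hF₁, hF₁', h₁⟩ := exists_shear (s := fun z : E × Y ↦ (h z.2 • e, (0 : Y)))
    (by fun_prop) (by simp) (by simp)
  obtain ⟨F₂, hF₂, hF₂', h₂⟩ := exists_shear
    (s := fun z : E × Y ↦ ((0 : E), g (projAlong ℓ ν z.2, η z.1) • ν))
    (by fun_prop) (by simp [hPν, -projAlong_apply]) (by simp [hPν, -projAlong_apply])
  obtain ⟨F₃, hF₃, hF₃', h₃⟩ := exists_shear
    (s := fun z : E × Y ↦ ((0 : E), -projAlong ℓ ν (k (η z.1, ℓ z.2))))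
    (by fun_prop) (by simp [hℓ]) (by simp [hℓ])
  refine ⟨F₁.trans (F₂.trans F₃), hF₃.comp (hF₂.comp hF₁), hF₁'.comp (hF₂'.comp hF₃'), ν, hν,
    fun j x hx ↦ ?_⟩
  have e₁ : F₁ (0, γ j x) = ((x 0 + 3 * j) • e, γ j x) := by
    rw [h₁, hhγ j x hx]
    simp
  have e₂ : F₂ ((x 0 + 3 * j) • e, γ j x) =
      ((x 0 + 3 * j) • e, projAlong ℓ ν (γ j x) + x 1 • ν) := by
    rw [h₂, ← hγγ' j hx]
    have := hgγ j x hx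
    simp only [map_smul, he, smul_eq_mul, mul_one, this]
    ext1
    · simp
    · simp only [Prod.mk_add_mk, projAlong_apply, sub_smul]
      abel
  have e₃ : F₃ ((x 0 + 3 * j) • e, projAlong ℓ ν (γ j x) + x 1 • ν) =
      ((x 0 + 3 * j) • e, x 1 • ν) := by
    rw [h₃, ← hγγ' j hx]
    have := hkγ j x hx
    simp [he, hℓ, this]
    abel
  rw [Equiv.trans_apply, Equiv.trans_apply, e₁, e₂, e₃]

end Unlinking

/-- An orthogonal splitting of Euclidean space. -/
lemma exists_euc_splitting {a b d : ℕ} (h : d = a + b) :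
    ∃ L : Euc d ≃L[ℝ] Euc a × Euc b, ∀ x, ‖(L x).1‖ ^ 2 + ‖(L x).2‖ ^ 2 = ‖x‖ ^ 2 := by
  have hr : Module.finrank ℝ (WithLp 2 (Euc a × Euc b)) = d := by
    rw [(WithLp.linearEquiv 2 ℝ (Euc a × Euc b)).finrank_eq]
    simp [h]
  let e := ((stdOrthonormalBasis ℝ (WithLp 2 (Euc a × Euc b))).reindex (finCongr hr)).repr.symm
  refine ⟨e.toContinuousLinearEquiv.trans (WithLp.prodContinuousLinearEquiv 2 ℝ _ _),
    fun x ↦ ?_⟩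
  rw [← e.norm_map x, WithLp.prod_norm_sq_eq_of_L2]
  rfl

/-! ### Thin framings of round spheres -/

section Framing

variable {V : Type*} [NormedAddCommGroup V] [NormedSpace ℝ V] [FiniteDimensional ℝ V]

lemma exists_linear_extension {k m : ℕ} (hV : Module.finrank ℝ V = k + m) {l : Euc k →L[ℝ] V}
    (hl : Function.Injective l) :
    ∃ L : (Euc k × Euc m) ≃L[ℝ] V, ∀ x, L (x, 0) = l x := by
  obtain ⟨C, hC⟩ := Submodule.exists_isCompl l.toLinearMap.range
  have hr : Module.finrank ℝ l.toLinearMap.range = k := by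
    rw [LinearMap.finrank_range_of_inj hl]
    simp
  have hC' : Module.finrank ℝ (Euc m) = Module.finrank ℝ C := by
    have := Submodule.finrank_add_eq_of_isCompl hC
    rw [finrank_euclideanSpace_fin]
    omega
  let e : Euc m ≃ₗ[ℝ] C := LinearEquiv.ofFinrankEq _ _ hC'
  let f : (Euc k × Euc m) →ₗ[ℝ] V := l.toLinearMap.coprod (C.subtype ∘ₗ e.toLinearMap)
  have hf : Function.Injective f := by
    refine (injective_iff_map_eq_zero f).2 ?_
    rintro ⟨x, s⟩ h
    have h' : l x = -(e s : V) := eq_neg_of_add_eq_zero_left h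
    have h0 : l x = 0 := Submodule.disjoint_def.1 hC.disjoint _ ⟨x, rfl⟩
      (h' ▸ C.neg_mem (e s).2)
    rw [h0, zero_eq_neg, ZeroMemClass.coe_eq_zero, e.map_eq_zero_iff] at h'
    rw [hl (h0.trans (map_zero l).symm), h']
    rfl
  refine ⟨(LinearEquiv.ofInjectiveOfFinrankEq f hf
    (by simp [hV])).toContinuousLinearEquiv, fun x ↦ ?_⟩
  change l x + (e 0 : V) = l x
  simp

/-- A round sphere in an affine subspace has a framing of arbitrarily small width. -/
lemma exists_framing_round_sphere {k d m : ℕ} (hd : d = m + 1)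
    (hV : Module.finrank ℝ V = k + m) {l : Euc k →L[ℝ] V} (hl : Function.Injective l) (c : V)
    {U : Set V} (hU : IsOpen U) (hcU : ∀ x ∈ unitSphere k, c + l x ∈ U) :
    ∃ σ : Euc k × Euc d → V, IsSmoothEmbeddingOn σ (unitSphere k ×ˢ unitBall d) ∧
      (∀ x, σ (x, 0) = c + l x) ∧ MapsTo σ (unitSphere k ×ˢ unitBall d) U := by
  subst hd
  obtain ⟨L, hL⟩ := exists_linear_extension hV hl
  let τ : Euc (m + 1) ≃L[ℝ] ℝ × Euc m :=
    (LinearEquiv.ofFinrankEq _ _ (by simp [add_comm])).toContinuousLinearEquiv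
  -- One normal coordinate rescales the radius, the other m move in a linear complement. At ε = 0
  -- this collapses to the core, so compactness gives a small ε > 0 that stays in `U`; polar
  -- coordinates provide the inverse.
  let σ : ℝ → Euc k × Euc (m + 1) → V :=
    fun ε z ↦ c + L ((1 + ε * (τ z.2).1) • z.1, ε • (τ z.2).2)
  have hσ : ContDiff ℝ ∞ (Function.uncurry σ) := by
    unfold Function.uncurry
    fun_prop
  let S : Set (Euc k × Euc (m + 1)) := unitSphere k ×ˢ unitBall (m + 1)
  have hS : IsCompact S := (isCompact_sphere 0 1).prod (isCompact_closedBall 0 1)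
  have hev : ∀ᶠ ε in 𝓝 (0 : ℝ), ∀ z ∈ S, σ ε z ∈ U ∧ 0 < 1 + ε * (τ z.2).1 := by
    refine hS.eventually_forall_of_forall_eventually fun z hz ↦ ?_
    refine Filter.Eventually.and ?_ ?_
    · refine (hσ.continuous.tendsto (0, z)).eventually (hU.mem_nhds ?_)
      simpa [σ, hL] using hcU z.1 hz.1
    · have hc : Continuous fun w : ℝ × (Euc k × Euc (m + 1)) ↦ 1 + w.1 * (τ w.2.2).1 := by
        fun_prop
      exact (hc.tendsto (0, z)).eventually (lt_mem_nhds (by simp))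
  obtain ⟨ε, hε, hε0⟩ :=
    ((hev.filter_mono nhdsWithin_le_nhds).and (self_mem_nhdsWithin (s := Ioi (0 : ℝ)))).exists
  have hε0' : ε ≠ 0 := ne_of_gt hε0
  refine ⟨σ ε, ⟨ContDiff.isSmoothOn (hσ.comp (contDiff_const.prodMk contDiff_id)) _,
    fun v ↦ (‖(L.symm (v - c)).1‖⁻¹ • (L.symm (v - c)).1,
      τ.symm (ε⁻¹ * (‖(L.symm (v - c)).1‖ - 1), ε⁻¹ • (L.symm (v - c)).2)), ?_, ?_⟩,
    fun x ↦ by simp [σ, hL], fun z hz ↦ (hε z hz).1⟩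
  · refine .of_contDiffOn fun v hv ↦ ⟨{v | (L.symm (v - c)).1 ≠ 0}, ?_, ?_, ?_⟩
    · exact isOpen_ne.preimage (f := fun v ↦ (L.symm (v - c)).1) (by fun_prop)
    · obtain ⟨z, hz, rfl⟩ := hv
      have hz1 : z.1 ≠ 0 := fun h ↦ by simpa [h] using hz.1
      simpa [σ, hz1] using (hε z hz).2.ne'
    · have h₁ : ContDiffOn ℝ ∞ (fun v ↦ (L.symm (v - c)).1) {v | (L.symm (v - c)).1 ≠ 0} := by
        fun_prop
      have h₂ : ContDiffOn ℝ ∞ (fun v ↦ ‖(L.symm (v - c)).1‖) {v | (L.symm (v - c)).1 ≠ 0} :=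
        h₁.norm ℝ fun v hv ↦ hv
      refine ((h₂.inv fun v hv ↦ norm_ne_zero_iff.2 hv).smul h₁).prodMk ?_
      refine τ.symm.contDiff.comp_contDiffOn (ContDiffOn.prodMk ?_ ?_)
      · exact contDiffOn_const.mul (h₂.sub contDiffOn_const)
      · fun_prop
  · rintro ⟨x, t⟩ hz
    have hpos := (hε _ hz).2
    have hx : ‖x‖ = 1 := mem_sphere_zero_iff_norm.1 hz.1
    simp only at hpos
    have hn : ‖(1 + ε * (τ t).1) • x‖ = 1 + ε * (τ t).1 := by
      rw [norm_smul, hx, mul_one, Real.norm_of_nonneg hpos.le]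
    simp only [σ, add_sub_cancel_left, ContinuousLinearEquiv.symm_apply_apply, hn]
    rw [smul_smul, inv_mul_cancel₀ hpos.ne', one_smul, smul_smul, inv_mul_cancel₀ hε0', one_smul,
      inv_mul_cancel_left₀ hε0', Prod.mk.eta, τ.symm_apply_apply]

end Framing

/-! ### The dotted part -/

section Dotted

variable {p q d : ℕ}

/-- The thickened disk `B^p × D × {0}` with corners rounded, parametrised by a ball. -/
def dottedBall (L : Euc d ≃L[ℝ] Euc p × Euc 2) (q : ℕ) (D : Euc 2 → Euc 3) (x : Euc d) :
    Euc p × Euc 3 × Euc q :=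
  ((L x).1, D (L x).2, 0)

lemma isTrivialBalls_inducedDotted {L : Euc d ≃L[ℝ] Euc p × Euc 2}
    (hL : ∀ x, ‖(L x).1‖ ^ 2 + ‖(L x).2‖ ^ 2 = ‖x‖ ^ 2) {a : ℕ} {D : Fin a → Euc 2 → Euc 3}
    (hD : IsSmoothEmbeddingFamily D (unitBall 2)) :
    IsTrivialBalls (fun i ↦ dottedBall L q (D i)) (inducedDotted p q D) := by
  have hmaps : MapsTo (fun x ↦ (L x).2) (unitBall d) (unitBall 2) := by
    intro x hx
    rw [mem_closedBall_zero_iff] at hx ⊢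
    have h₁ := hL x
    have h₂ : ‖x‖ ^ 2 ≤ 1 := pow_le_one₀ (norm_nonneg _) hx
    exact (sq_le_one_iff₀ (norm_nonneg _)).1 (by nlinarith [sq_nonneg ‖(L x).1‖])
  refine ⟨⟨fun i ↦ ?_, fun i j hij ↦ disjoint_left.2 ?_⟩, ?_⟩
  · obtain ⟨hs, g, hg, hgD⟩ := hD.1 i
    have hs₂ : IsSmoothOn (fun x ↦ (L x).2) (unitBall d) := ContDiff.isSmoothOn (by fun_prop) _
    refine ⟨(ContDiff.isSmoothOn (by fun_prop) _).prodMk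
      ((hs.comp hs₂ hmaps).prodMk (contDiff_const.isSmoothOn _)),
      fun z ↦ L.symm (z.1, g z.2.1), ?_, fun x hx ↦ ?_⟩
    · have h₁ : IsSmoothOn (fun z : Euc p × Euc 3 × Euc q ↦ z.1)
          (dottedBall L q (D i) '' unitBall d) := contDiff_fst.isSmoothOn _
      have h₂ : IsSmoothOn (fun z : Euc p × Euc 3 × Euc q ↦ z.2.1)
          (dottedBall L q (D i) '' unitBall d) := ContDiff.isSmoothOn (by fun_prop) _
      refine (L.symm.contDiff.isSmoothOn univ).comp (h₁.prodMk (hg.comp h₂ ?_)) (mapsTo_univ _ _)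
      rintro _ ⟨x, hx, rfl⟩
      exact ⟨_, hmaps hx, rfl⟩
    · have := hgD (hmaps hx)
      simp [dottedBall, this]
  · rintro _ ⟨x, hx, rfl⟩ ⟨y, hy, hxy⟩
    refine disjoint_left.1 (hD.2 hij) ⟨_, hmaps hx, rfl⟩ ⟨_, hmaps hy, ?_⟩
    exact congrArg (fun z ↦ z.2.1) hxy
  · ext z
    simp only [mem_iUnion, inducedDotted, mem_ofPred_eq]
    refine exists_congr fun i ↦ ⟨?_, ?_⟩
    · rintro ⟨x, hx, rfl⟩
      exact ⟨_, _, by rw [hL, mem_sphere_zero_iff_norm.1 hx, one_pow], rfl⟩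
    · rintro ⟨u, v, huv, rfl⟩
      have h := hL (L.symm (u, v))
      rw [L.apply_symm_apply, huv] at h
      refine ⟨L.symm (u, v), ?_, by simp [dottedBall]⟩
      rw [mem_sphere_zero_iff_norm]
      exact (pow_eq_one_iff_of_nonneg (norm_nonneg _) two_ne_zero).1 h.symm

end Dotted

/-! ### Slices, disjointness and the induced diagram -/

section Induced

variable {p q : ℕ}

lemma mem_slice {L : Set (Euc 3)} {x : Euc p × Euc 3 × Euc q} :
    x ∈ ({0} ×ˢ L ×ˢ {0} : Set (Euc p × Euc 3 × Euc q)) ↔ x.1 = 0 ∧ x.2.1 ∈ L ∧ x.2.2 = 0 :=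
  Iff.rfl

lemma sq_norm_eq_one_iff {X : Type*} [NormedAddCommGroup X] {x : X} :
    ‖x‖ ^ 2 = 1 ↔ x ∈ Metric.sphere 0 1 := by
  rw [mem_sphere_zero_iff_norm, pow_eq_one_iff_of_nonneg (norm_nonneg x) two_ne_zero]

lemma inducedDotted_inter_slice {a : ℕ} {D : Fin a → Euc 2 → Euc 3} {L : Set (Euc 3)}
    (hD : IsTrivialBalls D L) :
    inducedDotted p q D ∩ ({0} ×ˢ univ ×ˢ {0}) = {0} ×ˢ L ×ˢ {0} := by
  ext x
  rw [mem_inter_iff, mem_slice, mem_slice, ← hD.2]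
  constructor
  · rintro ⟨⟨i, u, v, h, rfl⟩, hu, -, -⟩
    obtain rfl : u = 0 := hu
    refine ⟨rfl, mem_iUnion.2 ⟨i, v, sq_norm_eq_one_iff.1 ?_, rfl⟩, rfl⟩
    simpa using h
  · rintro ⟨h₁, h₂, h₃⟩
    obtain ⟨i, v, hv, hvx⟩ := mem_iUnion.1 h₂
    refine ⟨⟨i, 0, v, ?_, Prod.ext h₁ (Prod.ext hvx.symm h₃)⟩, h₁, mem_univ _, h₃⟩
    simp [sq_norm_eq_one_iff.2 hv]

lemma inducedFramed_inter_slice {b : ℕ} {D : Fin b → Euc 2 → Euc p × Euc 3} {L : Set (Euc 3)}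
    (hD : IsTrivialBalls D ({0} ×ˢ L)) :
    inducedFramed p q D ∩ ({0} ×ˢ univ ×ˢ {0}) = {0} ×ˢ L ×ˢ {0} := by
  ext x
  rw [mem_inter_iff, mem_slice, mem_slice]
  constructor
  · rintro ⟨⟨j, v, w, h, rfl⟩, h₁, -, hw⟩
    obtain rfl : w = 0 := hw
    refine ⟨h₁, ?_, rfl⟩
    have : D j v ∈ ({0} ×ˢ L : Set (Euc p × Euc 3)) := by
      rw [← hD.2]
      exact mem_iUnion.2 ⟨j, v, sq_norm_eq_one_iff.1 (by simpa using h), rfl⟩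
    exact this.2
  · rintro ⟨h₁, h₂, h₃⟩
    have h : ((0, x.2.1) : Euc p × Euc 3) ∈ ⋃ j, D j '' unitSphere 2 := by
      rw [hD.2]
      exact ⟨rfl, h₂⟩
    obtain ⟨j, v, hv, hvx⟩ := mem_iUnion.1 h
    refine ⟨⟨j, v, 0, ?_, Prod.ext ?_ (Prod.ext ?_ h₃)⟩, h₁, mem_univ _, h₃⟩
    · simp [sq_norm_eq_one_iff.2 hv]
    · rw [h₁, hvx]
    · rw [hvx]

/-- Any common point is forced into the slice u = 0, w = 0, where the two sets cut out `L₁` and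
`L₂`. -/
lemma disjoint_inducedDotted_inducedFramed {a b : ℕ} {D₁ : Fin a → Euc 2 → Euc 3}
    {D₂ : Fin b → Euc 2 → Euc p × Euc 3} {L₁ L₂ : Set (Euc 3)} (hL : Disjoint L₁ L₂)
    (h₁ : IsTrivialBalls D₁ L₁) (h₂ : IsTrivialBalls D₂ ({0} ×ˢ L₂)) :
    Disjoint (inducedDotted p q D₁) (inducedFramed p q D₂) := by
  refine disjoint_left.2 fun x hx₁ hx₂ ↦ ?_
  have hw : x.2.2 = 0 := by
    obtain ⟨i, u, v, -, rfl⟩ := hx₁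
    rfl
  have hu : x.1 = 0 := by
    obtain ⟨j, v, w, h, rfl⟩ := hx₂
    obtain rfl : w = 0 := hw
    have : D₂ j v ∈ ({0} ×ˢ L₂ : Set (Euc p × Euc 3)) := by
      rw [← h₂.2]
      exact mem_iUnion.2 ⟨j, v, sq_norm_eq_one_iff.1 (by simpa using h), rfl⟩
    exact this.1
  have hx : x ∈ ({0} ×ˢ univ ×ˢ {0} : Set (Euc p × Euc 3 × Euc q)) := ⟨hu, mem_univ _, hw⟩
  have m₁ := (inducedDotted_inter_slice h₁).subset ⟨hx₁, hx⟩
  have m₂ := (inducedFramed_inter_slice h₂).subset ⟨hx₂, hx⟩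
  exact disjoint_left.1 hL m₁.2.1 m₂.2.1

lemma IsKirbyDiagram.disjoint {V : Type*} [NormedAddCommGroup V] [NormedSpace ℝ V] {n k : ℕ}
    {L₁ L₂ : Set V} (h : IsKirbyDiagram n k L₁ L₂) : Disjoint L₁ L₂ := by
  obtain ⟨a, b, φ, ψ, -, -, hd, rfl, rfl⟩ := h.exists_embedding
  simp only [disjoint_iUnion_left, disjoint_iUnion_right]
  intro i j
  exact (hd j i).mono_right (image_mono (prod_mono_right (by simp)))

/-- The framed part of a Kirby diagram is an embedded link. -/
lemma IsKirbyDiagram.exists_link {V : Type*} [NormedAddCommGroup V] [NormedSpace ℝ V] {n k : ℕ}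
    {L₁ L₂ : Set V} (h : IsKirbyDiagram n k L₁ L₂) :
    ∃ (b : ℕ) (γ : Fin b → Euc k → V), IsSmoothEmbeddingFamily γ (unitSphere k) ∧
      ⋃ j, γ j '' unitSphere k = L₂ := by
  obtain ⟨a, b, φ, ψ, -, hψ, -, -, rfl⟩ := h.exists_embedding
  have hm : MapsTo (fun x ↦ ((x, 0) : Euc k × Euc (n - k))) (unitSphere k)
      (unitSphere k ×ˢ unitBall (n - k)) := fun x hx ↦ ⟨hx, by simp⟩
  have hi : IsSmoothEmbeddingOn (fun x ↦ ((x, 0) : Euc k × Euc (n - k))) (unitSphere k) :=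
    isSmoothEmbeddingOn_of_leftInverse (g := Prod.fst) (by fun_prop) contDiff_fst (fun _ ↦ rfl) _
  have him : ∀ j, (fun x ↦ ψ j (x, 0)) '' unitSphere k = ψ j '' (unitSphere k ×ˢ {0}) := by
    intro j
    rw [prod_singleton, image_image]
  refine ⟨b, fun j x ↦ ψ j (x, 0), ⟨fun j ↦ (hψ.1 j).comp hi hm, fun i j hij ↦ ?_⟩, ?_⟩
  · simp only [him]
    exact (hψ.2 hij).mono (image_mono (prod_mono_right (by simp)))
      (image_mono (prod_mono_right (by simp)))
  · simp only [him]

theorem IsKirbyDiagram.exists_induced {n k : ℕ} (hp : 0 < p) (hk : k = q + 2)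
    (hn : n = p + k + 2) {L₁ L₂ : Set (Euc 3)} (hK : IsKirbyDiagram 4 2 L₁ L₂) {a : ℕ}
    {D₁ : Fin a → Euc 2 → Euc 3} (hD₁ : IsTrivialBalls D₁ L₁) :
    ∃ (b : ℕ) (D₂ : Fin b → Euc 2 → Euc p × Euc 3), IsTrivialBalls D₂ ({0} ×ˢ L₂) ∧
      IsKirbyDiagram n k (inducedDotted p q D₁) (inducedFramed p q D₂) := by
  obtain ⟨b, γ, hγ, hγL⟩ := hK.exists_link
  have : Nonempty (Fin p) := ⟨⟨0, hp⟩⟩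
  obtain ⟨e, he0⟩ := exists_ne (0 : Euc p)
  obtain ⟨η, he⟩ := SeparatingDual.exists_eq_one (R := ℝ) he0
  obtain ⟨F, hF, hF', ν, hν, hFγ⟩ := hγ.exists_unlinking (by simp) he
  obtain ⟨ℓ, hℓ⟩ := SeparatingDual.exists_eq_one (R := ℝ) hν
  let D₂ : Fin b → Euc 2 → Euc p × Euc 3 := fun j v ↦ F.symm ((v 0 + 3 * j) • e, v 1 • ν)
  have hD₂γ : ∀ j, ∀ x ∈ unitSphere 2, D₂ j x = (0, γ j x) := fun j x hx ↦ by
    simp only [D₂]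
    rw [← hFγ j x hx, F.symm_apply_apply]
  have hD₂ : IsTrivialBalls D₂ ({0} ×ˢ L₂) := by
    refine ⟨⟨fun j ↦ isSmoothEmbeddingOn_of_leftInverse
      (g := fun z ↦ pt (η (F z).1 - 3 * j) (ℓ (F z).2)) (hF'.comp (by fun_prop)) (by fun_prop)
      (fun v ↦ by simp [he, hℓ, pt_eta]) _, fun i j hij ↦ disjoint_left.2 ?_⟩, ?_⟩
    · rintro _ ⟨x, hx, rfl⟩ ⟨y, hy, hxy⟩
      have h := abs_add_three_mul_sub_lt (mem_closedBall_zero_iff.1 hy) j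
      have hxy' : y 0 + 3 * j = x 0 + 3 * (i : ℝ) := by
        have := congrArg (fun z ↦ η z.1) (F.symm.injective hxy)
        simpa [he] using this
      rw [hxy'] at h
      exact hij (eq_of_abs_sub_three_mul_lt
        (abs_add_three_mul_sub_lt (mem_closedBall_zero_iff.1 hx) i) h)
    · rw [← hγL, prod_iUnion]
      refine iUnion_congr fun j ↦ ?_
      rw [singleton_prod, image_image]
      exact image_congr (hD₂γ j)
  refine ⟨b, D₂, hD₂, ?_⟩
  obtain ⟨L, hL⟩ := exists_euc_splitting (a := p) (b := 2) (d := n - k) (by omega)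
  obtain ⟨K, hKn⟩ := exists_euc_splitting (a := 2) (b := q) (d := k) (by omega)
  have hM₁ := isTrivialBalls_inducedDotted (q := q) hL hD₁.1
  have hM₁c : IsCompact (inducedDotted p q D₁) := by
    rw [← hM₁.2]
    exact isCompact_iUnion fun i ↦ (isCompact_sphere 0 1).image_of_continuousOn
      ((hM₁.1.1 i).1.continuousOn.mono Metric.sphere_subset_closedBall)
  -- The inverse unlinking times the identity of ℝ^q; it carries the round spheres `c j + l x` onto
  -- the framed part.
  let G : Euc p × Euc 3 × Euc q → Euc p × Euc 3 × Euc q :=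
    fun z ↦ ((F.symm (z.1, z.2.1)).1, (F.symm (z.1, z.2.1)).2, z.2.2)
  let G' : Euc p × Euc 3 × Euc q → Euc p × Euc 3 × Euc q :=
    fun z ↦ ((F (z.1, z.2.1)).1, (F (z.1, z.2.1)).2, z.2.2)
  have hG : ContDiff ℝ ∞ G := by fun_prop
  have hG' : ContDiff ℝ ∞ G' := by fun_prop
  have hGG' : Function.LeftInverse G' G := fun z ↦ by simp [G, G']
  let l : Euc k →L[ℝ] Euc p × Euc 3 × Euc q := LinearMap.toContinuousLinearMap
    { toFun := fun x ↦ ((K x).1 0 • e, (K x).1 1 • ν, (K x).2)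
      map_add' := fun x y ↦ by simp [add_smul]
      map_smul' := fun r x ↦ by simp [mul_smul] }
  have hl : ∀ x, l x = ((K x).1 0 • e, (K x).1 1 • ν, (K x).2) := fun _ ↦ rfl
  have hli : Function.Injective l := by
    intro x y hxy
    rw [hl, hl, Prod.mk.injEq, Prod.mk.injEq] at hxy
    refine K.injective (Prod.ext ?_ hxy.2.2)
    rw [← pt_eta (K x).1, ← pt_eta (K y).1, smul_left_injective ℝ he0 hxy.1,
      smul_left_injective ℝ hν hxy.2.1]
  let c : Fin b → Euc p × Euc 3 × Euc q := fun j ↦ ((3 * (j : ℝ)) • e, 0, 0)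
  have hcore : ∀ j x, G (c j + l x) = ((D₂ j (K x).1).1, (D₂ j (K x).1).2, (K x).2) := by
    intro j x
    have : c j + l x = (((K x).1 0 + 3 * j) • e, (K x).1 1 • ν, (K x).2) := by
      simp [c, hl, add_smul, add_comm]
    rw [this]
  have hcore' : ∀ j, ∀ x ∈ unitSphere k, G (c j + l x) ∈ inducedFramed p q D₂ :=
    fun j x hx ↦ ⟨j, (K x).1, (K x).2, by rw [hKn, sq_norm_eq_one_iff.2 hx], hcore j x⟩
  have hdisj := disjoint_inducedDotted_inducedFramed (q := q) hK.disjoint hD₁ hD₂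
  -- The strips keep the framings of different components disjoint; the second condition keeps them
  -- off the dotted part after applying `G`.
  let U : Fin b → Set (Euc p × Euc 3 × Euc q) :=
    fun j ↦ {z | |η z.1 - 3 * j| < 3 / 2} ∩ G ⁻¹' (inducedDotted p q D₁)ᶜ
  have hU : ∀ j, IsOpen (U j) := fun j ↦
    (isOpen_lt (by fun_prop) continuous_const).inter
      (hM₁c.isClosed.isOpen_compl.preimage hG.continuous)
  have hcU : ∀ j, ∀ x ∈ unitSphere k, c j + l x ∈ U j := by
    refine fun j x hx ↦ ⟨?_, fun h ↦ disjoint_left.1 hdisj h (hcore' j x hx)⟩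
    have hx₁ : ‖(K x).1‖ ≤ 1 := by
      have h := hKn x
      rw [sq_norm_eq_one_iff.2 hx] at h
      exact (sq_le_one_iff₀ (norm_nonneg _)).1 (by nlinarith [sq_nonneg ‖(K x).2‖])
    have h := abs_add_three_mul_sub_lt hx₁ j
    rw [add_comm] at h
    simpa [c, hl, he] using h
  choose σ hσ hσ0 hσU using fun j ↦ exists_framing_round_sphere (d := n - k) (m := p + 1)
    (by omega) (by simp; omega) hli (c j) (hU j) (hcU j)
  refine ⟨by simp; omega, ⟨a, _, hM₁⟩, a, b, _, fun j ↦ G ∘ σ j,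
    hM₁.1.mono Metric.sphere_subset_closedBall, ⟨fun j ↦ ?_, fun i j hij ↦ ?_⟩, fun i j ↦ ?_,
    hM₁.2.symm, ?_⟩
  · exact (isSmoothEmbeddingOn_of_leftInverse hG hG' hGG' univ).comp (hσ j) (mapsTo_univ _ _)
  · refine disjoint_left.2 ?_
    rintro _ ⟨x, hx, rfl⟩ ⟨y, hy, hxy⟩
    have h : σ j y = σ i x := hGG'.injective hxy
    have hj := (hσU j hy).1
    rw [h] at hj
    exact hij (eq_of_abs_sub_three_mul_lt (hσU i hx).1 hj)
  · refine disjoint_left.2 ?_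
    rintro _ hx ⟨y, hy, rfl⟩
    exact (hσU j hy).2 (hM₁.2.subset (mem_iUnion.2 ⟨i, hx⟩))
  · ext z
    simp only [mem_iUnion, prod_singleton, image_image, Function.comp_apply, hσ0, hcore]
    refine exists_congr fun j ↦ ⟨?_, ?_⟩
    · rintro ⟨v, w, h, rfl⟩
      have hx := hKn (K.symm (v, w))
      rw [K.apply_symm_apply, h] at hx
      exact ⟨K.symm (v, w), sq_norm_eq_one_iff.1 hx.symm, by simp⟩
    · rintro ⟨x, hx, rfl⟩
      exact ⟨_, _, by rw [hKn, sq_norm_eq_one_iff.2 hx], rfl⟩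

end Induced

end KirbyDiag

theorem mainTheorem9 (n k : ℕ) (hk : 2 ≤ k) (hn : 2 * k ≤ n) (hnk : (n, k) ≠ (4, 2))
    (L₁ L₂ : Set (KirbyDiag.Euc 3)) (hK : KirbyDiag.IsKirbyDiagram 4 2 L₁ L₂) :
    KirbyDiag.IsTrivialLink 2 L₁ ∧
    ∀ (a : ℕ) (D₁ : Fin a → KirbyDiag.Euc 2 → KirbyDiag.Euc 3),
      KirbyDiag.IsTrivialBalls D₁ L₁ →
      ∃ (b : ℕ) (D₂ : Fin b → KirbyDiag.Euc 2 → KirbyDiag.Euc (n - k - 2) × KirbyDiag.Euc 3)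
        (M₁ M₂ : Set (KirbyDiag.Euc (n - k - 2) × KirbyDiag.Euc 3 × KirbyDiag.Euc (k - 2))),
        KirbyDiag.IsTrivialBalls D₂ ({0} ×ˢ L₂) ∧
        M₁ = KirbyDiag.inducedDotted (n - k - 2) (k - 2) D₁ ∧
        M₂ = KirbyDiag.inducedFramed (n - k - 2) (k - 2) D₂ ∧
        KirbyDiag.IsKirbyDiagram n k M₁ M₂ ∧
        M₁ ∩ ({0} ×ˢ Set.univ ×ˢ {0}) = {0} ×ˢ L₁ ×ˢ {0} ∧
        M₂ ∩ ({0} ×ˢ Set.univ ×ˢ {0}) = {0} ×ˢ L₂ ×ˢ {0} ∧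
        (M₁ ∪ M₂) ∩ ({0} ×ˢ Set.univ ×ˢ {0}) = {0} ×ˢ (L₁ ∪ L₂) ×ˢ {0} := by
  refine ⟨hK.trivial_dotted, fun a D₁ hD₁ ↦ ?_⟩
  -- If n ≤ k + 2, then 2k ≤ n forces k = 2 and n = 4, the excluded case with no spare direction.
  have hp : 0 < n - k - 2 := by
    by_contra h
    exact hnk (Prod.ext (by omega : n = 4) (by omega : k = 2))
  obtain ⟨b, D₂, hD₂, hM⟩ := hK.exists_induced (p := n - k - 2) (q := k - 2) (n := n) (k := k) hp
    (by omega) (by omega) hD₁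
  refine ⟨b, D₂, _, _, hD₂, rfl, rfl, hM, KirbyDiag.inducedDotted_inter_slice hD₁,
    KirbyDiag.inducedFramed_inter_slice hD₂, ?_⟩
  rw [Set.union_inter_distrib_right, KirbyDiag.inducedDotted_inter_slice hD₁,
    KirbyDiag.inducedFramed_inter_slice hD₂, Set.union_prod, Set.prod_union]
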